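/- Fix a real number $r>3$ and consider the surface of revolution $S=\{(x,x^r\cos y,x^r\sin y): x>0\}\subset\mathbb{R}^3$ with the induced metric (only its part $0<x\le d_0$ near the cusp $x=0$ matters below). For $d_0>0$ let $C=\{x=d_0\}$, let $V$ be the unit vector field along $C$ tangent to the meridians and pointing to the cusp, and let $JV$ be the unit vector field tangent to $C$ in the direction of increasing $y$. The unit tangent vectors of $S$ based on $C$ form a surface $N$ with coordinates $(y,\beta)$, where $v=\cos\beta\, V+\sin\beta\, JV$. For $0<|\beta|<\pi/2$ the geodesic $\gamma$ starting at $v=(y,\beta)$ returns to $C$ for a first time $T(\beta)>0$; put $F(v)=\dot\gamma(T(\beta))\in N$. Measure a vector $\xi$ tangent to $N$ at $v$ by $\|\xi\|=|a|+|b|$, where $a$ and $b$ are the components along $Jv=-\sin\beta\,V+\cos\beta\,JV$ of the derivative of the foot point of $v$ and of the covariant derivative of $v$ in the direction $\xi$. Let $$\Lambda=\frac{\|DF(\partial/\partial\beta)\|}{\|\partial/\partial\beta\|}$$ be the expansion factor; that is, $\Lambda=j(T(\beta))+j'(T(\beta))$ for the perpendicular Jacobi field along $\gamma$ with $j(0)=0$,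 $j'(0)=1$. **Proposition.** For all $d_0>0$ and $0<|\beta|<\pi/2$ the map $F$ is well defined and differentiable at $(y,\beta)$, and $\Lambda$ is positive there and depends only on $\beta$. Moreover: 1. (One-step growth.) For every real $\nu>r/(r-1)$ there is $\delta>0$ such that for every $0<d_0<\delta$ there is an integer $k_0\ge 1$ with $$\sum_{k=k_0}^{\infty}\Lambda_k^{-1}<1,\qquad\text{where}\quad \Lambda_k=\min_{(k+1)^{-\nu}\le|\beta|\le k^{-\nu}}\Lambda(\beta)>0$$ (the minimum is attained for every $k\ge k_0$). 2. (Distortion bound.) There are $\nu>r/(r-1)$ and $\theta>1+2/r$ with $\nu\theta<\nu+1$, and $\delta>0$, such that for every $0<d_0<\delta$ there is $C>0$ such that $\Lambda$ is differentiable at every $\beta$ with $0<|\beta|<\pi/2$ and $$\left|\frac{\Lambda'(\beta)}{\Lambda(\beta)}\right|\le \frac{C}{|\beta|^{\theta}}\qquad\text{for all } 0<|\beta|<\pi/2 .$$ -/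

import Mathlib

open Real Set

noncomputable section

namespace ToyCusp

/-! The surface of revolution `{(x, x ^ r * cos y, x ^ r * sin y) : 0 < x}` of the profile `v = u ^ r`,
in the coordinates `(x, y)`. The angle `y` is lifted to the real line. The induced metric is
`E ^ 2 dx ^ 2 + G ^ 2 dy ^ 2` with `E ^ 2 = 1 + (r * x ^ (r - 1)) ^ 2` and `G = x ^ r`. -/

/-- Length of the coordinate vector `∂/∂x` (tangent to the meridian) at height `x`. -/
def meridianSpeed (r x : ℝ) : ℝ := √(1 + (r * x ^ (r - 1)) ^ 2)

/-- `(x, y)`, with coordinate velocity `(vx, vy)`, is a geodesic of the surface of revolution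
on the time interval `[0, T]`. With `E = meridianSpeed r x` and `G = x ^ r` the two last fields
are the geodesic equations
`x'' = (G * G_x * y' ^ 2 - E * E_x * x' ^ 2) / E ^ 2` and `y'' = - 2 * (G_x / G) * x' * y'`. -/
structure IsGeodesicOn (r T : ℝ) (x y vx vy : ℝ → ℝ) : Prop where
  pos : ∀ t ∈ Icc 0 T, 0 < x t
  deriv_x : ∀ t ∈ Icc 0 T, HasDerivWithinAt x (vx t) (Icc 0 T) t
  deriv_y : ∀ t ∈ Icc 0 T, HasDerivWithinAt y (vy t) (Icc 0 T) t
  deriv_vx : ∀ t ∈ Icc 0 T, HasDerivWithinAt vx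
    ((r * x t ^ (2 * r - 1) * vy t ^ 2 - r ^ 2 * (r - 1) * x t ^ (2 * r - 3) * vx t ^ 2) /
      meridianSpeed r (x t) ^ 2) (Icc 0 T) t
  deriv_vy : ∀ t ∈ Icc 0 T, HasDerivWithinAt vy
    (-(2 * r * vx t * vy t / x t)) (Icc 0 T) t

/-- The coordinate velocity `(a, b)`, based at a point of the parallel `C = {x = d}`, is the unit
vector `v(β) = cos β • V + sin β • JV`, where `V` is the unit vector tangent to the meridian
that points to the cusp and `JV` is the unit vector tangent to `C`, in the direction of `∂/∂y`. -/
def IsUnitVector (r d β a b : ℝ) : Prop :=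
  meridianSpeed r d * a = -cos β ∧ d ^ r * b = sin β

/-- The points `(y, β)` of `M \ Σ`: unit vectors based on `C` that point towards the cusp, without
those that are tangent to a meridian (`β = 0`). -/
def incoming : Set (ℝ × ℝ) := {p | p.2 ≠ 0 ∧ |p.2| < π / 2}

/-- The geodesic that starts at the unit vector `p = (y, β)` based on the parallel `C = {x = d}`
comes back to `C` for the first time at time `T`, with the unit vector `q` as its velocity. -/
def IsFirstReturnAt (r d : ℝ) (p : ℝ × ℝ) (T : ℝ) (q : ℝ × ℝ) : Prop :=
  0 < T ∧ q.2 ∈ Ioc (-π) π ∧ ∃ x y vx vy : ℝ → ℝ, IsGeodesicOn r T x y vx vy ∧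
    x 0 = d ∧ y 0 = p.1 ∧ IsUnitVector r d p.2 (vx 0) (vy 0) ∧
    (∀ t ∈ Ioo 0 T, x t ≠ d) ∧
    x T = d ∧ y T = q.1 ∧ IsUnitVector r d q.2 (vx T) (vy T)

/-- The first-return map `F` to the unit vectors based on `C = {x = d}`, in the coordinates
`(y, β)`. -/
def firstReturn (r d : ℝ) (p : ℝ × ℝ) : ℝ × ℝ :=
  Classical.epsilon fun q => ∃ T, IsFirstReturnAt r d p T q

/-- The norm of a vector `ξ = (δy, δβ)` tangent, at the unit vector `p = (y, β)`, to the space of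
unit vectors `v` based on `C = {x = d}`. It is the sum of the absolute values of the components
along `Jv = -sin β • V + cos β • JV` of the velocity of the foot point (`δy • ∂/∂y`, of length
`d ^ r * |δy|`) and of the covariant derivative of `v`, that is of
`(δβ - G'(d) / E(d) * δy) • Jv`. So it is `|j| + |j'|` for the perpendicular Jacobi field
`j • Jv` defined by `ξ`. -/
def jacobiNorm (r d : ℝ) (p ξ : ℝ × ℝ) : ℝ :=
  |d ^ r * cos p.2 * ξ.1| + |ξ.2 - r * d ^ (r - 1) / meridianSpeed r d * ξ.1|

/-- The expansion factor `‖DF(p) w‖ / ‖w‖` of the first-return map along `w = ∂/∂β`. -/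
def expansionAt (r d : ℝ) (p : ℝ × ℝ) : ℝ :=
  jacobiNorm r d (firstReturn r d p) (fderiv ℝ (firstReturn r d) p (0, 1)) /
    jacobiNorm r d p (0, 1)

/-- The expansion factor as a function `Λ(β)` of `β` only. -/
def expansion (r d β : ℝ) : ℝ := expansionAt r d (0, β)

/-- The angles `β` in the closure of the homogeneity strip of index `k`. -/
def strip (ν : ℝ) (k : ℕ) : Set ℝ :=
  {β | 1 / ((k : ℝ) + 1) ^ ν ≤ |β| ∧ |β| ≤ 1 / (k : ℝ) ^ ν}

/-- `Λ_k`, the minimum of the expansion factor over the homogeneity strip of index `k`. -/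
def stripMin (r d ν : ℝ) (k : ℕ) : ℝ := sInf (expansion r d '' strip ν k)

end ToyCusp

end

noncomputable section

namespace ToyCusp

open Filter Topology MeasureTheory

/-! ### Integrals that depend on a parameter and start at it -/

/-! A geodesic entering the cusp is parametrized by its angle `α` with the meridian. Clairaut's
relation `x ^ r * sin α = d ^ r * sin β` gives the height, `α` runs from `β` to `π - β`, and `dy/dα
= twist r d (sin α / sin β) / r`. So for `β > 0` the return map is explicit: `(y, β) ↦ (y + sweep β,
π - β)`; reflection in `y` gives `β < 0`. Uniqueness for the geodesic equation identifies it with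
`firstReturn`.

With `R = -sweep'` and `κ = G'(d) / E(d)`, the definition of the norm gives `Λ = (d ^ r * cos β + κ)
* R - 1`. Differentiating under the integral yields `R = 2 / r * (twist 1 + cot β * K)`, where `K`
integrates the logarithmic derivative of `twist`. Since `κ * R ≥ 2`, the `-1` costs at most half: `Λ
≥ κ * R / 2`.

Growth: `K` is bounded below for `|β| ≤ 1`, so `Λ ≥ c / |β|` and `Λ_k ≥ c * k ^ ν`. As `ν > 1`, a
tail of the series has sum below 1. Distortion: termwise comparison gives `|R'| ≤ 3 * R / β`, whence
`|Λ'| ≤ C * Λ / |β|`. This is stronger than the exponent `θ > 1` asks; `r > 3` leaves room to choose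
`ν` and `θ`. -/

theorem hasDerivAt_integral_diagonal {G : ℝ → ℝ → ℝ} {b : ℝ}
    (hG : ContinuousAt (Function.uncurry G) (b, b))
    (hint : ∀ᶠ β in 𝓝 b, IntervalIntegrable (G β) volume b β) :
    HasDerivAt (fun β => ∫ α in b..β, G β α) (G b b) b := by
  rw [hasDerivAt_iff_isLittleO, Asymptotics.isLittleO_iff]
  intro ε hε
  obtain ⟨δ, hδ, hball⟩ := Metric.continuousAt_iff.1 hG ε hε
  filter_upwards [hint, Metric.ball_mem_nhds b hδ] with β hβ hβδ
  rw [Metric.mem_ball, Real.dist_eq] at hβδ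
  have hsub : (∫ α in b..β, G β α) - (∫ α in b..b, G b α) - (β - b) • G b b
      = ∫ α in b..β, (G β α - G b b) := by
    rw [intervalIntegral.integral_sub hβ intervalIntegrable_const]
    simp
  rw [hsub, Real.norm_eq_abs (β - b)]
  refine intervalIntegral.norm_integral_le_of_norm_le_const fun α hα => ?_
  have hα' : |α - b| ≤ |β - b| := by
    rcases le_total b β with h | h
    · rw [uIoc_of_le h] at hα
      rw [abs_of_nonneg (by linarith [hα.1]), abs_of_nonneg (by linarith)]
      linarith [hα.2]
    · rw [uIoc_of_ge h] at hα
      rw [abs_of_nonpos (by linarith [hα.2]), abs_of_nonpos (by linarith)]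
      linarith [hα.1]
  have := @hball (β, α) (by
    rw [Prod.dist_eq, Real.dist_eq, Real.dist_eq]
    exact max_lt hβδ (hα'.trans_lt hβδ))
  rw [Real.dist_eq] at this
  exact this.le

/-- Leibniz rule, by splitting `∫ β..c` as `∫ b..c` minus `∫ b..β`. The first is differentiated
under the integral sign, with a compactness bound on `G'`; in the second only the corner value `G b
b` survives. -/
theorem hasDerivAt_integral_of_lower_limit {G G' : ℝ → ℝ → ℝ} {l u b c : ℝ}
    (hG : ContinuousOn (Function.uncurry G) (Ioo l u ×ˢ Ioo l u))
    (hG' : ContinuousOn (Function.uncurry G') (Ioo l u ×ˢ Ioo l u))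
    (hd : ∀ β ∈ Ioo l u, ∀ α ∈ Ioo l u, HasDerivAt (fun β => G β α) (G' β α) β)
    (hb : b ∈ Ioo l u) (hc : c ∈ Ioo l u) :
    HasDerivAt (fun β => ∫ α in β..c, G β α) ((∫ α in b..c, G' b α) - G b b) b := by
  have hsec : ∀ H : ℝ → ℝ → ℝ, ContinuousOn (Function.uncurry H) (Ioo l u ×ˢ Ioo l u) →
      ∀ β ∈ Ioo l u, ContinuousOn (H β) (Ioo l u) := fun H hH β hβ =>
    hH.comp (f := fun α => (β, α)) (by fun_prop) fun α hα => ⟨hβ, hα⟩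
  have hii : ∀ H : ℝ → ℝ → ℝ, ContinuousOn (Function.uncurry H) (Ioo l u ×ˢ Ioo l u) →
      ∀ β ∈ Ioo l u, ∀ s ∈ Ioo l u, ∀ t ∈ Ioo l u, IntervalIntegrable (H β) volume s t :=
    fun H hH β hβ s hs t ht =>
      ((hsec H hH β hβ).mono (ordConnected_Ioo.uIcc_subset hs ht)).intervalIntegrable
  have hnhds : Ioo l u ∈ 𝓝 b := isOpen_Ioo.mem_nhds hb
  obtain ⟨ρ, hρ, hρs⟩ := Metric.nhds_basis_closedBall.mem_iff.1 hnhds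
  have hcomp : IsCompact (Metric.closedBall b ρ ×ˢ uIcc b c) :=
    (isCompact_closedBall b ρ).prod isCompact_uIcc
  have hsub : Metric.closedBall b ρ ×ˢ uIcc b c ⊆ Ioo l u ×ˢ Ioo l u :=
    prod_mono hρs (ordConnected_Ioo.uIcc_subset hb hc)
  obtain ⟨M, hM⟩ := hcomp.exists_bound_of_continuousOn (hG'.mono hsub)
  have h1 : HasDerivAt (fun β => ∫ α in b..c, G β α) (∫ α in b..c, G' b α) b := by
    refine (intervalIntegral.hasDerivAt_integral_of_dominated_loc_of_deriv_le
      (Metric.closedBall_mem_nhds b hρ) ?_ (hii G hG b hb b hb c hc) ?_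
      (bound := fun _ => M) ?_ intervalIntegrable_const ?_).2
    · filter_upwards [hnhds] with β hβ
      exact (intervalIntegrable_iff.1 (hii G hG β hβ b hb c hc)).aestronglyMeasurable
    · exact (intervalIntegrable_iff.1 (hii G' hG' b hb b hb c hc)).aestronglyMeasurable
    · exact Eventually.of_forall fun α hα β hβ => hM (β, α) ⟨hβ, uIoc_subset_uIcc hα⟩
    · exact Eventually.of_forall fun α hα β hβ =>
        hd β (hρs hβ) α (ordConnected_Ioo.uIcc_subset hb hc (uIoc_subset_uIcc hα))
  have h2 : HasDerivAt (fun β => ∫ α in b..β, G β α) (G b b) b := by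
    refine hasDerivAt_integral_diagonal
      (hG.continuousAt (prod_mem_nhds hnhds hnhds)) ?_
    filter_upwards [hnhds] with β hβ
    exact hii G hG β hβ b hb β hβ
  refine (h1.sub h2).congr_of_eventuallyEq ?_
  filter_upwards [hnhds] with β hβ
  exact (intervalIntegral.integral_interval_sub_left (hii G hG β hβ b hb c hc)
    (hii G hG β hβ b hb β hβ)).symm

/-- The integral of `g (sin α / sin β)` over the angles `α` between `β` and `π / 2`. -/
def sineIntegral (g : ℝ → ℝ) (β : ℝ) : ℝ := ∫ α in β..π / 2, g (sin α / sin β)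

theorem continuousOn_sine_ratio {g : ℝ → ℝ} (hg : ContinuousOn g (Ioi 0)) :
    ContinuousOn (Function.uncurry fun β α => g (sin α / sin β)) (Ioo 0 π ×ˢ Ioo 0 π) := by
  refine hg.comp (f := fun p : ℝ × ℝ => sin p.2 / sin p.1) ?_ ?_
  · refine ContinuousOn.div (by fun_prop) (by fun_prop) ?_
    rintro ⟨β, α⟩ ⟨hβ, -⟩
    exact (sin_pos_of_mem_Ioo hβ).ne'
  · rintro ⟨β, α⟩ ⟨hβ, hα⟩
    exact div_pos (sin_pos_of_mem_Ioo hα) (sin_pos_of_mem_Ioo hβ)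

/-- For `w = sin α / sin β` one has `∂w/∂β = -cot β * w`. With `g'` denoting the logarithmic
derivative `w * dg/dw`, the derivative is again expressed through a `sineIntegral`, so the rule can
be iterated. -/
theorem hasDerivAt_sineIntegral {g g' : ℝ → ℝ} (hg : ∀ w, 0 < w → HasDerivAt g (g' w / w) w)
    (hg' : ContinuousOn g' (Ioi 0)) {β : ℝ} (hβ : β ∈ Ioo 0 π) :
    HasDerivAt (sineIntegral g) (-(g 1 + cot β * sineIntegral g' β)) β := by
  have hgc : ContinuousOn g (Ioi 0) := fun w hw => (hg w hw).continuousAt.continuousWithinAt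
  have hs := sin_pos_of_mem_Ioo hβ
  have key := hasDerivAt_integral_of_lower_limit (b := β) (c := π / 2)
    (G := fun β α => g (sin α / sin β)) (G' := fun β α => -(cos β / sin β * g' (sin α / sin β)))
    (continuousOn_sine_ratio hgc) ?_ ?_ hβ ⟨by positivity, by linarith [pi_pos]⟩
  · refine key.congr_deriv ?_
    simp only [intervalIntegral.integral_neg, intervalIntegral.integral_const_mul, sineIntegral,
      cot_eq_cos_div_sin, div_self hs.ne']
    ring
  · refine ContinuousOn.neg (ContinuousOn.mul (ContinuousOn.div (by fun_prop) (by fun_prop) ?_)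
      (continuousOn_sine_ratio hg'))
    rintro ⟨β, α⟩ ⟨hβ, -⟩
    exact (sin_pos_of_mem_Ioo hβ).ne'
  · intro β hβ α hα
    have hs := sin_pos_of_mem_Ioo hβ
    have ha := sin_pos_of_mem_Ioo hα
    have h := (hg _ (div_pos ha hs)).comp β
      (((hasDerivAt_const β (sin α)).div (hasDerivAt_sin β) hs.ne'))
    refine h.congr_deriv ?_
    field_simp
    ring

theorem sine_ratio_mem {β α : ℝ} (hβ : β ∈ Ioo 0 (π / 2)) (hα : α ∈ Icc β (π / 2)) :
    1 ≤ sin α / sin β := by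
  rw [one_le_div (sin_pos_of_mem_Ioo ⟨hβ.1, by linarith [hβ.2, pi_pos]⟩)]
  exact sin_le_sin_of_le_of_le_pi_div_two (by linarith [hβ.1, pi_pos]) hα.2 hα.1

theorem intervalIntegrable_sine_ratio {g : ℝ → ℝ} (hg : ContinuousOn g (Ioi 0)) {β : ℝ}
    (hβ : β ∈ Ioo 0 (π / 2)) :
    IntervalIntegrable (fun α => g (sin α / sin β)) volume β (π / 2) := by
  refine ContinuousOn.intervalIntegrable ?_
  refine (continuousOn_sine_ratio hg).comp (f := fun α => (β, α)) (by fun_prop) ?_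
  rw [uIcc_of_le hβ.2.le]
  exact fun α hα => ⟨⟨hβ.1, by linarith [hβ.2, pi_pos]⟩, by linarith [hβ.1, hα.1],
    by linarith [hα.2, pi_pos]⟩

theorem sineIntegral_mono {f g : ℝ → ℝ} (hf : ContinuousOn f (Ioi 0)) (hg : ContinuousOn g (Ioi 0))
    (h : ∀ w, 1 ≤ w → f w ≤ g w) {β : ℝ} (hβ : β ∈ Ioo 0 (π / 2)) :
    sineIntegral f β ≤ sineIntegral g β :=
  intervalIntegral.integral_mono_on hβ.2.le (intervalIntegrable_sine_ratio hf hβ)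
    (intervalIntegrable_sine_ratio hg hβ) fun _ hα => h _ (sine_ratio_mem hβ hα)

theorem sineIntegral_const (c β : ℝ) : sineIntegral (fun _ => c) β = (π / 2 - β) * c := by
  simp [sineIntegral]

theorem sineIntegral_const_mul (c : ℝ) (g : ℝ → ℝ) (β : ℝ) :
    sineIntegral (fun w => c * g w) β = c * sineIntegral g β := by
  simp [sineIntegral]

/-- The integral of `sin α / sin β` over `β ≤ α ≤ π / 2` is `cot β`. -/
theorem sineIntegral_id (β : ℝ) : sineIntegral (fun w => w) β = cot β := by
  simp [sineIntegral, cot_eq_cos_div_sin, intervalIntegral.integral_div]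

/-! ### The geodesics, parametrized by their angle with the meridians -/

theorem meridianSpeed_pos (r x : ℝ) : 0 < meridianSpeed r x := by
  unfold meridianSpeed; positivity

theorem one_le_meridianSpeed (r x : ℝ) : 1 ≤ meridianSpeed r x := by
  unfold meridianSpeed
  rw [Real.one_le_sqrt]
  nlinarith [sq_nonneg (r * x ^ (r - 1))]

theorem sq_meridianSpeed (r x : ℝ) : meridianSpeed r x ^ 2 = 1 + (r * x ^ (r - 1)) ^ 2 :=
  Real.sq_sqrt (by positivity)

theorem hasDerivAt_meridianSpeed (r : ℝ) {x : ℝ} (hx : 0 < x) :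
    HasDerivAt (meridianSpeed r)
      (r ^ 2 * (r - 1) * x ^ (2 * r - 3) / meridianSpeed r x) x := by
  have h := ((((Real.hasDerivAt_rpow_const (p := r - 1) (Or.inl hx.ne')).const_mul r).pow
    2).const_add 1).sqrt (by simp only [Pi.pow_apply]; positivity)
  refine h.congr_deriv ?_
  have e : x ^ (2 * r - 3) = x ^ (r - 1) * x ^ (r - 1 - 1) := by
    rw [← Real.rpow_add hx]; ring_nf
  rw [e]
  unfold meridianSpeed
  have : √(1 + (r * x ^ (r - 1)) ^ 2) ≠ 0 := by positivity
  simp only [Pi.pow_apply]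
  field_simp
  ring

/-- The rate, per unit of angle with the meridian, at which a geodesic turns around the axis. -/
def twist (r d w : ℝ) : ℝ := √(r ^ 2 + d ^ (2 - 2 * r) * w ^ (2 - 2 / r))

/-- The height at which the sine of the angle with the meridian is `S`, along a geodesic for which
it is `s` at height `d` (Clairaut's relation). -/
def clairautHeight (r d s S : ℝ) : ℝ := d * (s / S) ^ (1 / r)

theorem clairautHeight_pos {r d s S : ℝ} (hd : 0 < d) (hs : 0 < s) (hS : 0 < S) :
    0 < clairautHeight r d s S := by
  unfold clairautHeight; positivity

theorem clairautHeight_self {r d s : ℝ} (hs : 0 < s) : clairautHeight r d s s = d := by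
  simp [clairautHeight, div_self hs.ne']

theorem clairautHeight_lt {r d s S : ℝ} (hr : 0 < r) (hd : 0 < d) (hs : 0 < s) (h : s < S) :
    clairautHeight r d s S < d := by
  unfold clairautHeight
  have : (s / S) ^ (1 / r) < 1 := by
    refine Real.rpow_lt_one (by have := hs.trans h; positivity) ?_ (by positivity)
    rw [div_lt_one (hs.trans h)]; exact h
  nlinarith

theorem hasDerivAt_clairautHeight (r d : ℝ) {s S : ℝ} (hs : 0 < s) (hS : 0 < S) :
    HasDerivAt (clairautHeight r d s) (-(clairautHeight r d s S / (r * S))) S := by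
  have h := ((((hasDerivAt_const S s).div (hasDerivAt_id S) hS.ne').rpow_const (p := 1 / r)
    (Or.inl (div_pos hs hS).ne')).const_mul d)
  refine h.congr_deriv ?_
  unfold clairautHeight
  simp only [Pi.div_apply, id]
  rw [Real.rpow_sub_one (div_pos hs hS).ne']
  field_simp
  ring

/-- Clairaut's relation reads `S / s = (d / X) ^ r`, so the second term under the root of `twist` is
`X ^ (2 - 2 * r)`; factoring it out leaves `meridianSpeed`. -/
theorem twist_eq {r d s S : ℝ} (hr : 0 < r) (hd : 0 < d) (hs : 0 < s) (hS : 0 < S) :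
    twist r d (S / s) = meridianSpeed r (clairautHeight r d s S) *
      clairautHeight r d s S / clairautHeight r d s S ^ r := by
  have hX := clairautHeight_pos (r := r) hd hs hS
  have hw : d ^ (2 - 2 * r) * (S / s) ^ (2 - 2 / r) = (clairautHeight r d s S ^ (r - 1))⁻¹ ^ 2 := by
    unfold clairautHeight
    rw [← inv_div s S, Real.inv_rpow (by positivity), Real.mul_rpow hd.le (by positivity),
      ← Real.rpow_mul (by positivity), mul_inv, mul_pow, ← Real.rpow_neg (by positivity),
      ← Real.rpow_neg (by positivity), ← Real.rpow_neg (by positivity), ← Real.rpow_mul_natCast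
      (by positivity), ← Real.rpow_mul_natCast (by positivity)]
    congr 2
    · push_cast; ring
    · push_cast; field_simp
  rw [twist, hw]
  set X := clairautHeight r d s S
  have e : X ^ (r - 1) = X ^ r / X := Real.rpow_sub_one hX.ne' r
  have hP : 0 < X ^ r := by positivity
  rw [mul_div_assoc, show X / X ^ r = (X ^ (r - 1))⁻¹ by rw [e, inv_div], meridianSpeed]
  rw [← Real.sqrt_sq (show 0 ≤ (X ^ (r - 1))⁻¹ by positivity), ← Real.sqrt_mul (by positivity),
    Real.sqrt_sq (show 0 ≤ (X ^ (r - 1))⁻¹ by positivity)]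
  congr 1
  have : X ^ (r - 1) ≠ 0 := by positivity
  field_simp
  ring

theorem continuous_twist {r : ℝ} (hr : 1 < r) (d : ℝ) : Continuous (twist r d) := by
  have h : 0 ≤ 2 - 2 / r := by
    rw [sub_nonneg, div_le_iff₀ (by linarith)]; linarith
  unfold twist
  exact Real.continuous_sqrt.comp
    (continuous_const.add (continuous_const.mul (Real.continuous_rpow_const h)))

/-- The change of `y` along a geodesic of initial angle `β`, between its two visits of the
parallel `C = {x = d}`. -/
def sweep (r d β : ℝ) : ℝ := 2 / r * sineIntegral (twist r d) β

/-- The reflection `α ↦ π - α` exchanges the descending and ascending halves of the geodesic. -/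
theorem integral_twist_eq_sweep {r : ℝ} (hr : 1 < r) (d β : ℝ) :
    ∫ α in β..(π - β), twist r d (sin α / sin β) / r = sweep r d β := by
  have hc : Continuous fun α => twist r d (sin α / sin β) :=
    (continuous_twist hr d).comp (by fun_prop)
  have h : ∫ α in (π / 2)..(π - β), twist r d (sin α / sin β)
      = ∫ α in β..(π / 2), twist r d (sin α / sin β) := by
    have := intervalIntegral.integral_comp_sub_left
      (fun α => twist r d (sin α / sin β)) π (a := β) (b := π / 2)
    simp only [sin_pi_sub] at this
    rw [this]
    congr 1
    ring
  rw [intervalIntegral.integral_div, ← intervalIntegral.integral_add_adjacent_intervals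
    (hc.intervalIntegrable β (π / 2)) (hc.intervalIntegrable _ _), h, sweep, sineIntegral]
  ring

/-- `σ` is the time spent per unit of angle. Its primitive `τ` is an increasing bijection of the
line, and `A` is the inverse. -/
theorem exists_angle_of_time {σ : ℝ → ℝ} (hσ : Continuous σ) {c : ℝ} (hc : 0 < c)
    (h : ∀ a, c ≤ σ a) (a₀ : ℝ) : ∃ A : ℝ → ℝ, A 0 = a₀ ∧ StrictMono A ∧ Function.Surjective A ∧
      ∀ t, HasDerivAt A (σ (A t))⁻¹ t := by
  set τ : ℝ → ℝ := fun a => ∫ u in a₀..a, σ u with hτ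
  have hd : ∀ a, HasDerivAt τ (σ a) a := fun a => hσ.integral_hasStrictDerivAt a₀ a |>.hasDerivAt
  have hτ0 : τ a₀ = 0 := by simp [hτ]
  have hmono : StrictMono τ := strictMono_of_deriv_pos fun a => by
    rw [(hd a).deriv]; exact hc.trans_le (h a)
  -- Comparison with a line of slope `c` makes `τ` unbounded in both directions, hence surjective.
  have hlin : Monotone fun a => τ a - c * a := by
    refine monotone_of_deriv_nonneg (fun a => ((hd a).sub
      ((hasDerivAt_id a).const_mul c)).differentiableAt) fun a => ?_
    have := ((hd a).sub ((hasDerivAt_id a).const_mul c)).deriv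
    simp only [id, mul_one] at this
    have e : (fun a => τ a - c * a) = (τ - fun y => c * y) := rfl
    rw [e, this]
    linarith [h a]
  have hcont : Continuous τ := continuous_iff_continuousAt.2 fun a => (hd a).continuousAt
  have htop : Tendsto (fun a => c * (a - a₀)) atTop atTop :=
    (tendsto_atTop_add_const_right _ _ tendsto_id).const_mul_atTop hc
  have hbot : Tendsto (fun a => c * (a - a₀)) atBot atBot :=
    (tendsto_atBot_add_const_right _ _ tendsto_id).const_mul_atBot hc
  have hsurj : Function.Surjective τ := by
    refine hcont.surjective (tendsto_atTop_mono' _ ?_ htop) (tendsto_atBot_mono' _ ?_ hbot)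
    · filter_upwards [eventually_ge_atTop a₀] with a ha
      have := hlin ha
      simp only [hτ0] at this
      linarith
    · filter_upwards [eventually_le_atBot a₀] with a ha
      have := hlin ha
      simp only [hτ0] at this
      linarith
  let e := hmono.orderIsoOfSurjective τ hsurj
  have he : ∀ t, τ (e.symm t) = t := fun t => e.apply_symm_apply t
  refine ⟨e.symm, ?_, e.symm.strictMono, e.symm.surjective, fun t => ?_⟩
  · rw [e.symm_apply_eq]; exact hτ0.symm
  · exact HasDerivAt.of_local_left_inverse e.symm.continuous.continuousAt (hd _)
      (hc.trans_le (h _)).ne' (Eventually.of_forall he)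

theorem sin_le_sin_of_mem_Icc {β a : ℝ} (hβ : β ∈ Ioo 0 (π / 2)) (ha : a ∈ Icc β (π - β)) :
    sin β ≤ sin a := by
  rcases le_total a (π / 2) with h | h
  · exact sin_le_sin_of_le_of_le_pi_div_two (by linarith [hβ.1, pi_pos]) h ha.1
  · rw [← sin_pi_sub a]
    exact sin_le_sin_of_le_of_le_pi_div_two (by linarith [hβ.1, pi_pos]) (by linarith)
      (by linarith [ha.2])

theorem sin_lt_sin_of_mem_Ioo {β a : ℝ} (hβ : β ∈ Ioo 0 (π / 2)) (ha : a ∈ Ioo β (π - β)) :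
    sin β < sin a := by
  rcases le_total a (π / 2) with h | h
  · exact sin_lt_sin_of_lt_of_le_pi_div_two (by linarith [hβ.1, pi_pos]) h ha.1
  · rw [← sin_pi_sub a]
    exact sin_lt_sin_of_lt_of_le_pi_div_two (by linarith [hβ.1, pi_pos]) (by linarith)
      (by linarith [ha.2])

/-- The geodesic is written down from the angle `A t` and Clairaut's height, and the equations are
checked. Strictly between the end angles `sin (A t) > sin β`, so the height stays below `d` and the
return is the first. -/
theorem isFirstReturnAt_sweep {r d : ℝ} (hr : 1 < r) (hd : 0 < d) {β : ℝ}
    (hβ : β ∈ Ioo 0 (π / 2)) (y₀ : ℝ) :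
    ∃ T, IsFirstReturnAt r d (y₀, β) T (y₀ + sweep r d β, π - β) := by
  have hr0 : 0 < r := by linarith
  have hs : 0 < sin β := sin_pos_of_mem_Ioo ⟨hβ.1, by linarith [hβ.2, pi_pos]⟩
  set s := sin β with hsdef
  set X := clairautHeight r d s with hX
  -- Truncating the sine at `s` keeps the time density defined and bounded below on the whole line;
  -- on `[β, π - β]` nothing changes.
  set m : ℝ → ℝ := fun a => max (sin a) s with hm
  have hmpos : ∀ a, 0 < m a := fun a => lt_max_of_lt_right hs
  have hmc : Continuous m := by fun_prop
  have hm1 : ∀ a, m a ≤ 1 := fun a => max_le (sin_le_one a) (sin_le_one β)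
  have hXpos : ∀ S, 0 < S → 0 < X S := fun S hS => clairautHeight_pos hd hs hS
  have hXm : Continuous fun a => X (m a) := continuous_iff_continuousAt.2 fun a =>
    (hasDerivAt_clairautHeight r d hs (hmpos a)).continuousAt.comp hmc.continuousAt
  have hEm : Continuous fun a => meridianSpeed r (X (m a)) := continuous_iff_continuousAt.2 fun a =>
    ContinuousAt.comp (f := fun a => X (m a))
      (hasDerivAt_meridianSpeed r (hXpos _ (hmpos a))).continuousAt hXm.continuousAt
  obtain ⟨A, hA0, hAm, hAs, hAd⟩ := exists_angle_of_time
    (σ := fun a => X (m a) * meridianSpeed r (X (m a)) / (r * m a))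
    ((hXm.mul hEm).div (by fun_prop) fun a => (mul_pos hr0 (hmpos a)).ne')
    -- This constant bounds the density below, from `m a ≤ 1` and `meridianSpeed ≥ 1`.
    (c := d * s ^ (1 / r) / r) (by positivity) (fun a => by
      have h1 : d * s ^ (1 / r) ≤ X (m a) := by
        rw [hX, clairautHeight]
        have : s ≤ s / m a := by
          rw [le_div_iff₀ (hmpos a)]; nlinarith [hm1 a]
        gcongr
      have h2 : X (m a) ≤ X (m a) * meridianSpeed r (X (m a)) :=
        le_mul_of_one_le_right (hXpos _ (hmpos a)).le (one_le_meridianSpeed _ _)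
      have h3 : r * m a ≤ r := by nlinarith [hm1 a]
      have h4 : 0 < r * m a := mul_pos hr0 (hmpos a)
      exact div_le_div₀ (by have := hXpos _ (hmpos a); have := meridianSpeed_pos r (X (m a)); positivity)
        (h1.trans h2) h4 h3) β
  obtain ⟨T, hT⟩ := hAs (π - β)
  have hT0 : 0 < T := by
    rw [← hAm.lt_iff_lt, hA0, hT]; linarith [hβ.2]
  have hmem : ∀ t ∈ Icc 0 T, A t ∈ Icc β (π - β) := fun t ht => by
    rw [← hT, ← hA0]; exact ⟨hAm.monotone ht.1, hAm.monotone ht.2⟩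
  have hS : ∀ t ∈ Icc 0 T, 0 < sin (A t) := fun t ht =>
    hs.trans_le (sin_le_sin_of_mem_Icc hβ (hmem t ht))
  have hA' : ∀ t ∈ Icc 0 T, HasDerivAt A
      (r * sin (A t) / (X (sin (A t)) * meridianSpeed r (X (sin (A t))))) t := fun t ht => by
    have hmax : m (A t) = sin (A t) := max_eq_left (sin_le_sin_of_mem_Icc hβ (hmem t ht))
    simpa only [hmax, inv_div] using hAd t
  have hx' : ∀ t ∈ Icc 0 T, HasDerivAt (fun t => X (sin (A t)))
      (-(cos (A t) / meridianSpeed r (X (sin (A t))))) t := fun t ht => by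
    have := (hasDerivAt_clairautHeight r d hs (hS t ht)).comp t (hA' t ht).sin
    refine this.congr_deriv ?_
    have h1 := hS t ht
    have h2 := hXpos _ h1
    have h3 := meridianSpeed_pos r (X (sin (A t)))
    rw [← hX]
    field_simp
  have htw : Continuous fun a => twist r d (sin a / s) / r :=
    ((continuous_twist hr d).comp (by fun_prop)).div_const r
  refine ⟨T, hT0, ⟨?_, ?_⟩, fun t => X (sin (A t)),
    fun t => y₀ + ∫ a in β..A t, twist r d (sin a / s) / r,
    fun t => -(cos (A t) / meridianSpeed r (X (sin (A t)))),
    fun t => sin (A t) / X (sin (A t)) ^ r, ⟨?_, ?_, ?_, ?_, ?_⟩, ?_, ?_, ⟨?_, ?_⟩, ?_, ?_, ?_,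
    ⟨?_, ?_⟩⟩
  · simp only; linarith [hβ.1, hβ.2, pi_pos]
  · simp only; linarith [hβ.1]
  · exact fun t ht => hXpos _ (hS t ht)
  · exact fun t ht => (hx' t ht).hasDerivWithinAt
  · intro t ht
    refine HasDerivAt.hasDerivWithinAt ?_
    have := (((htw.integral_hasStrictDerivAt β (A t)).hasDerivAt.comp t (hA' t ht))).const_add y₀
    refine this.congr_deriv ?_
    have h1 := hS t ht
    have h2 := hXpos _ h1
    have h3 := meridianSpeed_pos r (X (sin (A t)))
    have h4 : 0 < X (sin (A t)) ^ r := by positivity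
    rw [twist_eq hr0 hd hs h1, ← hX]
    field_simp
  · intro t ht
    refine HasDerivAt.hasDerivWithinAt ?_
    have h1 := hS t ht
    have h2 := hXpos _ h1
    have h3 := meridianSpeed_pos r (X (sin (A t)))
    have h4 : 0 < X (sin (A t)) ^ r := by positivity
    have hE := (hasDerivAt_meridianSpeed r h2).comp t (hx' t ht)
    refine (((hA' t ht).cos.div hE h3.ne').neg).congr_deriv ?_
    have e : X (sin (A t)) ^ (2 * r - 1) = X (sin (A t)) ^ r * X (sin (A t)) ^ r / X (sin (A t)) := by
      rw [Real.rpow_sub_one h2.ne', two_mul, Real.rpow_add h2]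
    rw [e]
    simp only [Function.comp]
    generalize X (sin (A t)) ^ (2 * r - 3) = Q
    field_simp
    ring
  · intro t ht
    refine HasDerivAt.hasDerivWithinAt ?_
    have h1 := hS t ht
    have h2 := hXpos _ h1
    have h3 := meridianSpeed_pos r (X (sin (A t)))
    have h4 : 0 < X (sin (A t)) ^ r := by positivity
    refine ((hA' t ht).sin.div ((hx' t ht).rpow_const (p := r) (Or.inl h2.ne'))
      h4.ne').congr_deriv ?_
    rw [Real.rpow_sub_one h2.ne']
    field_simp
    ring
  · simp only [hA0]; exact clairautHeight_self hs
  · simp [hA0]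
  · simp only [hA0, ← hsdef, hX, clairautHeight_self hs]
    field_simp [(meridianSpeed_pos r d).ne']
  · simp only [hA0, ← hsdef, hX, clairautHeight_self hs]
    have : 0 < d ^ r := by positivity
    field_simp
  · intro t ht
    have hin : A t ∈ Ioo β (π - β) := by
      rw [← hT, ← hA0]; exact ⟨hAm ht.1, hAm ht.2⟩
    exact (clairautHeight_lt hr0 hd hs (sin_lt_sin_of_mem_Ioo hβ hin)).ne
  · simp only [hT, sin_pi_sub]; exact clairautHeight_self hs
  · simp only [hT, integral_twist_eq_sweep hr, hsdef]
  · simp only [hT, sin_pi_sub, ← hsdef, hX, clairautHeight_self hs]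
    field_simp [(meridianSpeed_pos r d).ne']
  · simp only [hT, sin_pi_sub, ← hsdef, hX, clairautHeight_self hs]
    have : 0 < d ^ r := by positivity
    field_simp

/-- The metric is invariant under `y ↦ -y`. The angle `π` is excluded because `-π` is not a
normalized angle. -/
theorem IsFirstReturnAt.neg {r d T : ℝ} {p q : ℝ × ℝ} (h : IsFirstReturnAt r d p T q)
    (hq : q.2 ≠ π) : IsFirstReturnAt r d (-p) T (-q) := by
  obtain ⟨hT, hq2, x, y, vx, vy, hg, hx0, hy0, hv0, hne, hxT, hyT, hvT⟩ := h
  refine ⟨hT, ⟨?_, ?_⟩, x, -y, vx, -vy, ⟨hg.pos, hg.deriv_x, ?_, ?_, ?_⟩, hx0, ?_, ?_, hne, hxT,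
    ?_, ?_⟩
  · simpa using lt_of_le_of_ne hq2.2 hq
  · simpa using neg_le.1 hq2.1.le
  · exact fun t ht => (hg.deriv_y t ht).neg
  · exact fun t ht => by simpa using hg.deriv_vx t ht
  · intro t ht
    refine (hg.deriv_vy t ht).neg.congr_deriv ?_
    simp only [Pi.neg_apply]
    ring
  · simp [hy0]
  · simpa [IsUnitVector] using hv0
  · simp [hyT]
  · simpa [IsUnitVector] using hvT

/-! ### Uniqueness of geodesics and of the first return -/

/-- The field need be regular only near the two trajectories: their traces form a compact set, on
which a `C¹` field is Lipschitz, and the usual uniqueness theorem applies there. -/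
theorem eqOn_Icc_of_contDiffAt_vectorField {E : Type*} [NormedAddCommGroup E] [NormedSpace ℝ E]
    {v : E → E} {f g : ℝ → E} {a b : ℝ}
    (hf : ∀ t ∈ Icc a b, HasDerivWithinAt f (v (f t)) (Icc a b) t)
    (hg : ∀ t ∈ Icc a b, HasDerivWithinAt g (v (g t)) (Icc a b) t)
    (hvf : ∀ t ∈ Icc a b, ContDiffAt ℝ 1 v (f t)) (hvg : ∀ t ∈ Icc a b, ContDiffAt ℝ 1 v (g t))
    (hab : f a = g a) : EqOn f g (Icc a b) := by
  have hfc : ContinuousOn f (Icc a b) := fun t ht => (hf t ht).continuousWithinAt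
  have hgc : ContinuousOn g (Icc a b) := fun t ht => (hg t ht).continuousWithinAt
  have hK : IsCompact (f '' Icc a b ∪ g '' Icc a b) :=
    (isCompact_Icc.image_of_continuousOn hfc).union (isCompact_Icc.image_of_continuousOn hgc)
  have hv : ∀ p ∈ f '' Icc a b ∪ g '' Icc a b, ContDiffAt ℝ 1 v p := by
    rintro p (⟨t, ht, rfl⟩ | ⟨t, ht, rfl⟩)
    exacts [hvf t ht, hvg t ht]
  obtain ⟨K, hK⟩ := LocallyLipschitzOn.exists_lipschitzOnWith_of_compact hK (f := v)
    fun p hp => by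
      obtain ⟨K, t, ht, h⟩ := (hv p hp).exists_lipschitzOnWith
      exact ⟨K, t, mem_nhdsWithin_of_mem_nhds ht, h⟩
  have hIci : ∀ t ∈ Ico a b, Icc a b ∈ 𝓝[Ici t] t := fun t ht =>
    mem_of_superset (Icc_mem_nhdsGE ht.2) (Icc_subset_Icc_left ht.1)
  exact ODE_solution_unique_of_mem_Icc_right (v := fun _ => v)
    (s := fun _ => f '' Icc a b ∪ g '' Icc a b) (fun _ _ => hK) hfc
    (fun t ht => (hf t (Ico_subset_Icc_self ht)).mono_of_mem_nhdsWithin (hIci t ht))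
    (fun t ht => Or.inl ⟨t, Ico_subset_Icc_self ht, rfl⟩) hgc
    (fun t ht => (hg t (Ico_subset_Icc_self ht)).mono_of_mem_nhdsWithin (hIci t ht))
    (fun t ht => Or.inr ⟨t, Ico_subset_Icc_self ht, rfl⟩) hab

/-- The geodesic vector field, in the coordinates `((x, y), (vx, vy))`. -/
def geodesicField (r : ℝ) (p : (ℝ × ℝ) × ℝ × ℝ) : (ℝ × ℝ) × ℝ × ℝ :=
  (p.2, ((r * p.1.1 ^ (2 * r - 1) * p.2.2 ^ 2 - r ^ 2 * (r - 1) * p.1.1 ^ (2 * r - 3) * p.2.1 ^ 2) /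
      meridianSpeed r p.1.1 ^ 2, -(2 * r * p.2.1 * p.2.2 / p.1.1)))

theorem contDiffAt_geodesicField (r : ℝ) {p : (ℝ × ℝ) × ℝ × ℝ} (hp : 0 < p.1.1) :
    ContDiffAt ℝ 1 (geodesicField r) p := by
  have hpow : ∀ s : ℝ, ContDiffAt ℝ 1 (fun p : (ℝ × ℝ) × ℝ × ℝ => p.1.1 ^ s) p := fun s =>
    ContDiffAt.rpow_const_of_ne (f := fun p : (ℝ × ℝ) × ℝ × ℝ => p.1.1) (by fun_prop) hp.ne'
  have hE : ContDiffAt ℝ 1 (fun p : (ℝ × ℝ) × ℝ × ℝ => meridianSpeed r p.1.1 ^ 2) p := by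
    simp only [sq_meridianSpeed]
    exact contDiffAt_const.add ((contDiffAt_const.mul (hpow _)).pow 2)
  have h1 := hpow (2 * r - 1)
  have h3 := hpow (2 * r - 3)
  refine ContDiffAt.prodMk contDiffAt_snd (ContDiffAt.prodMk ?_ ?_)
  · refine ContDiffAt.div ?_ hE (pow_pos (meridianSpeed_pos _ _) 2).ne'
    exact ((contDiffAt_const.mul h1).mul (by fun_prop)).sub
      ((contDiffAt_const.mul h3).mul (by fun_prop))
  · exact (ContDiffAt.div (f := fun p : (ℝ × ℝ) × ℝ × ℝ => 2 * r * p.2.1 * p.2.2)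
      (g := fun p : (ℝ × ℝ) × ℝ × ℝ => p.1.1) (by fun_prop) (by fun_prop) hp.ne').neg

theorem IsGeodesicOn.hasDerivWithinAt {r T : ℝ} {x y vx vy : ℝ → ℝ}
    (h : IsGeodesicOn r T x y vx vy) (t : ℝ) (ht : t ∈ Icc 0 T) :
    HasDerivWithinAt (fun t => ((x t, y t), vx t, vy t))
      (geodesicField r ((x t, y t), vx t, vy t)) (Icc 0 T) t :=
  ((h.deriv_x t ht).prodMk (h.deriv_y t ht)).prodMk ((h.deriv_vx t ht).prodMk (h.deriv_vy t ht))

theorem IsGeodesicOn.mono {r T T' : ℝ} {x y vx vy : ℝ → ℝ} (h : IsGeodesicOn r T x y vx vy)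
    (hT : T' ≤ T) : IsGeodesicOn r T' x y vx vy := by
  have hs : Icc 0 T' ⊆ Icc 0 T := Icc_subset_Icc_right hT
  exact ⟨fun t ht => h.pos t (hs ht), fun t ht => (h.deriv_x t (hs ht)).mono hs,
    fun t ht => (h.deriv_y t (hs ht)).mono hs, fun t ht => (h.deriv_vx t (hs ht)).mono hs,
    fun t ht => (h.deriv_vy t (hs ht)).mono hs⟩

theorem IsGeodesicOn.eqOn {r T : ℝ} {x y vx vy x' y' vx' vy' : ℝ → ℝ}
    (h : IsGeodesicOn r T x y vx vy) (h' : IsGeodesicOn r T x' y' vx' vy')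
    (h0 : ((x 0, y 0), vx 0, vy 0) = ((x' 0, y' 0), vx' 0, vy' 0)) :
    EqOn (fun t => ((x t, y t), vx t, vy t)) (fun t => ((x' t, y' t), vx' t, vy' t)) (Icc 0 T) :=
  eqOn_Icc_of_contDiffAt_vectorField h.hasDerivWithinAt h'.hasDerivWithinAt
    (fun t ht => contDiffAt_geodesicField r (h.pos t ht))
    (fun t ht => contDiffAt_geodesicField r (h'.pos t ht)) h0

theorem eq_of_cos_sin_eq {a b : ℝ} (ha : a ∈ Ioc (-π) π) (hb : b ∈ Ioc (-π) π)
    (hc : cos a = cos b) (hs : sin a = sin b) : a = b := by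
  have h : (a : Real.Angle) = b := Real.Angle.cos_sin_inj hc hs
  rw [← Real.Angle.toReal_coe_eq_self_iff_mem_Ioc.2 ha, h,
    Real.Angle.toReal_coe_eq_self_iff_mem_Ioc.2 hb]

/-- By uniqueness both geodesics agree up to `T`. If `T < T'`, the second would meet `C` too early;
if `T = T'`, the common velocity fixes the cosine and sine of the angle. -/
theorem IsFirstReturnAt.unique_of_le {r d T T' : ℝ} (hd : 0 < d) {p q q' : ℝ × ℝ}
    (h : IsFirstReturnAt r d p T q) (h' : IsFirstReturnAt r d p T' q') (hTT : T ≤ T') : q = q' := by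
  obtain ⟨hT, hq, x, y, vx, vy, hg, hx0, hy0, hv0, -, hxT, hyT, hvT⟩ := h
  obtain ⟨-, hq', x', y', vx', vy', hg', hx0', hy0', hv0', hne', -, hyT', hvT'⟩ := h'
  have hE := (meridianSpeed_pos r d).ne'
  have hD : d ^ r ≠ 0 := by positivity
  have h0 : ((x 0, y 0), vx 0, vy 0) = ((x' 0, y' 0), vx' 0, vy' 0) := by
    simp only [Prod.mk.injEq]
    exact ⟨⟨hx0.trans hx0'.symm, hy0.trans hy0'.symm⟩,
      mul_left_cancel₀ hE (hv0.1.trans hv0'.1.symm), mul_left_cancel₀ hD (hv0.2.trans hv0'.2.symm)⟩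
  have heq := hg.eqOn (hg'.mono hTT) h0 (right_mem_Icc.2 hT.le)
  simp only [Prod.mk.injEq] at heq
  obtain ⟨⟨ex, ey⟩, evx, evy⟩ := heq
  rcases hTT.lt_or_eq with hlt | rfl
  · exact absurd (ex.symm.trans hxT) (hne' T ⟨hT, hlt⟩)
  · refine Prod.ext (by rw [← hyT, ← hyT', ey]) (eq_of_cos_sin_eq hq hq' ?_ ?_)
    · exact neg_injective (by rw [← hvT.1, ← hvT'.1, evx])
    · rw [← hvT.2, ← hvT'.2, evy]

theorem IsFirstReturnAt.unique {r d T T' : ℝ} (hd : 0 < d) {p q q' : ℝ × ℝ}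
    (h : IsFirstReturnAt r d p T q) (h' : IsFirstReturnAt r d p T' q') : q = q' := by
  rcases le_total T T' with hT | hT
  · exact h.unique_of_le hd h' hT
  · exact (h'.unique_of_le hd h hT).symm

theorem firstReturn_eq {r d T : ℝ} (hd : 0 < d) {p q : ℝ × ℝ} (h : IsFirstReturnAt r d p T q) :
    firstReturn r d p = q := by
  have hex : ∃ q, ∃ T, IsFirstReturnAt r d p T q := ⟨q, T, h⟩
  obtain ⟨T', h'⟩ := Classical.epsilon_spec hex
  exact IsFirstReturnAt.unique hd h' h

theorem exists_isFirstReturnAt_of_pos {r d : ℝ} (hr : 1 < r) (hd : 0 < d) {p : ℝ × ℝ}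
    (h0 : 0 < p.2) (h1 : p.2 < π / 2) :
    ∃ T, IsFirstReturnAt r d p T (p.1 + sweep r d p.2, π - p.2) :=
  isFirstReturnAt_sweep hr hd ⟨h0, h1⟩ p.1

theorem exists_isFirstReturnAt_of_neg {r d : ℝ} (hr : 1 < r) (hd : 0 < d) {p : ℝ × ℝ}
    (h0 : p.2 < 0) (h1 : -(π / 2) < p.2) :
    ∃ T, IsFirstReturnAt r d p T (p.1 - sweep r d (-p.2), -π - p.2) := by
  obtain ⟨T, h⟩ := exists_isFirstReturnAt_of_pos hr hd (p := -p) (neg_pos.2 h0)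
    (by simpa using neg_lt.1 h1)
  refine ⟨T, ?_⟩
  have := h.neg (by simpa using h0.ne)
  simp only [neg_neg, Prod.neg_mk, Prod.snd_neg, Prod.fst_neg] at this
  convert this using 2 <;> ring

/-! ### The derivative of the first-return map -/

/-- The logarithmic derivative `w * twist' w` of `twist`. -/
def twistSlope (r d w : ℝ) : ℝ := (1 - 1 / r) * (twist r d w - r ^ 2 / twist r d w)

/-- The second logarithmic derivative of `twist`. -/
def twistCurvature (r d w : ℝ) : ℝ :=
  (1 - 1 / r) * (1 + r ^ 2 / twist r d w ^ 2) * twistSlope r d w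

/-! ### Bounds for `twist` and its logarithmic derivatives -/

section twist

variable {r d w : ℝ}

theorem le_twist (hd : 0 < d) (hw : 0 < w) : r ≤ twist r d w := by
  refine Real.le_sqrt_of_sq_le ?_
  have : 0 < d ^ (2 - 2 * r) * w ^ (2 - 2 / r) := by positivity
  linarith

theorem twist_pos (hr : 0 < r) (hd : 0 < d) (hw : 0 < w) : 0 < twist r d w :=
  hr.trans_le (le_twist hd hw)

theorem lt_twist_one (hd : 0 < d) : r < twist r d 1 := by
  refine Real.lt_sqrt_of_sq_lt ?_
  have : 0 < d ^ (2 - 2 * r) * (1 : ℝ) ^ (2 - 2 / r) := by positivity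
  linarith

theorem sq_twist (hd : 0 < d) (hw : 0 < w) :
    twist r d w ^ 2 = r ^ 2 + d ^ (2 - 2 * r) * w ^ (2 - 2 / r) :=
  Real.sq_sqrt (by positivity)

theorem hasDerivAt_twist (hr : 0 < r) (hd : 0 < d) (hw : 0 < w) :
    HasDerivAt (twist r d) (twistSlope r d w / w) w := by
  have ht := twist_pos hr hd hw
  have h := (((Real.hasDerivAt_rpow_const (p := 2 - 2 / r) (Or.inl hw.ne')).const_mul
    (d ^ (2 - 2 * r))).const_add (r ^ 2)).sqrt (by
      have : 0 < d ^ (2 - 2 * r) * w ^ (2 - 2 / r) := by positivity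
      positivity)
  refine h.congr_deriv ?_
  change _ / (2 * twist r d w) = _
  rw [Real.rpow_sub_one hw.ne', twistSlope]
  have e := sq_twist (r := r) hd hw
  generalize w ^ (2 - 2 / r) = Q at e ⊢
  generalize d ^ (2 - 2 * r) = D at e ⊢
  field_simp
  rw [e]
  ring

theorem hasDerivAt_twistSlope (hr : 0 < r) (hd : 0 < d) (hw : 0 < w) :
    HasDerivAt (twistSlope r d) (twistCurvature r d w / w) w := by
  have ht := twist_pos hr hd hw
  have h := hasDerivAt_twist hr hd hw
  refine ((h.sub ((hasDerivAt_const w (r ^ 2)).div h ht.ne')).const_mul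
    (1 - 1 / r)).congr_deriv ?_
  rw [twistCurvature]
  field_simp
  ring

theorem continuousOn_twist (hr : 0 < r) (hd : 0 < d) : ContinuousOn (twist r d) (Ioi 0) :=
  fun _ hw => (hasDerivAt_twist hr hd hw).continuousAt.continuousWithinAt

theorem continuousOn_twistSlope (hr : 0 < r) (hd : 0 < d) :
    ContinuousOn (twistSlope r d) (Ioi 0) :=
  fun _ hw => (hasDerivAt_twistSlope hr hd hw).continuousAt.continuousWithinAt

theorem continuousOn_twistCurvature (hr : 0 < r) (hd : 0 < d) :
    ContinuousOn (twistCurvature r d) (Ioi 0) := by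
  refine ContinuousOn.mul (continuousOn_const.mul (continuousOn_const.add
    (continuousOn_const.div ((continuousOn_twist hr hd).pow 2) ?_))) (continuousOn_twistSlope hr hd)
  exact fun w hw => (pow_pos (twist_pos hr hd hw) 2).ne'

theorem twist_mono (hr : 1 < r) (hd : 0 < d) (hw : 1 ≤ w) : twist r d 1 ≤ twist r d w := by
  have h : 0 ≤ 2 - 2 / r := by
    rw [sub_nonneg, div_le_iff₀ (by linarith)]; linarith
  unfold twist
  have := Real.one_le_rpow hw h
  rw [Real.one_rpow]
  gcongr

theorem one_sub_inv_pos (hr : 1 < r) : 0 < 1 - 1 / r := by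
  rw [sub_pos, div_lt_one (by linarith)]; exact hr

theorem twistSlope_one_pos (hr : 1 < r) (hd : 0 < d) : 0 < twistSlope r d 1 := by
  have hr0 : 0 < r := by linarith
  have h := lt_twist_one (r := r) hd
  refine mul_pos (one_sub_inv_pos hr) ?_
  rw [sub_pos, div_lt_iff₀ (by linarith)]
  nlinarith

/-- Both `twist` and `t ↦ t - r ^ 2 / t` are increasing. -/
theorem twistSlope_one_le (hr : 1 < r) (hd : 0 < d) (hw : 1 ≤ w) :
    twistSlope r d 1 ≤ twistSlope r d w := by
  have hr0 : 0 < r := by linarith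
  have h1 := lt_twist_one (r := r) hd
  have h2 := twist_mono hr hd hw
  have h3 := (one_sub_inv_pos hr).le
  have h4 : 0 < twist r d 1 := by linarith
  unfold twistSlope
  gcongr

theorem twistSlope_nonneg (hr : 1 < r) (hd : 0 < d) (hw : 1 ≤ w) : 0 ≤ twistSlope r d w :=
  (twistSlope_one_pos hr hd).le.trans (twistSlope_one_le hr hd hw)

/-- A majorant linear in `w` is wanted because `w` integrates to `cot β`. It holds since `twist`
grows with exponent `1 - 1 / r < 1`. -/
theorem twistSlope_le (hr : 1 < r) (hd : 0 < d) (hw : 1 ≤ w) :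
    twistSlope r d w ≤ twist r d 1 * w := by
  have hr0 : 0 < r := by linarith
  have hw0 : 0 < w := by linarith
  have ht := twist_pos hr0 hd hw0
  have h1 : twistSlope r d w ≤ twist r d w := by
    have ha := one_sub_inv_pos hr
    have hb : 1 - 1 / r ≤ 1 := by have : 0 < 1 / r := by positivity
                                  linarith
    have hc : 0 ≤ r ^ 2 / twist r d w := by positivity
    unfold twistSlope
    nlinarith
  refine h1.trans ?_
  refine Real.sqrt_le_iff.2 ⟨by have := twist_pos hr0 hd one_pos; positivity, ?_⟩
  rw [mul_pow, sq_twist hd one_pos, Real.one_rpow, mul_one, add_mul]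
  have e : w ^ (2 - 2 / r) ≤ w ^ 2 := by
    rw [← Real.rpow_natCast w 2]
    refine Real.rpow_le_rpow_of_exponent_le hw ?_
    have : 0 < 2 / r := by positivity
    push_cast; linarith
  gcongr
  exact le_mul_of_one_le_right (sq_nonneg r) (one_le_pow₀ hw)

theorem twistCurvature_nonneg (hr : 1 < r) (hd : 0 < d) (hw : 1 ≤ w) :
    0 ≤ twistCurvature r d w := by
  have h1 := one_sub_inv_pos hr
  have h2 := twistSlope_nonneg hr hd hw
  unfold twistCurvature
  positivity

theorem twistCurvature_le (hr : 1 < r) (hd : 0 < d) (hw : 1 ≤ w) :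
    twistCurvature r d w ≤ 2 * twistSlope r d w := by
  have hr0 : 0 < r := by linarith
  have h2 := twistSlope_nonneg hr hd hw
  have h3 := le_twist (r := r) hd (show 0 < w by linarith)
  have h4 : r ^ 2 / twist r d w ^ 2 ≤ 1 := div_le_one_of_le₀ (by gcongr) (by positivity)
  have h5 : 0 ≤ r ^ 2 / twist r d w ^ 2 := by positivity
  have h6 := one_sub_inv_pos hr
  have h7 : 1 - 1 / r ≤ 1 := by have : 0 < 1 / r := by positivity
                                linarith
  unfold twistCurvature
  gcongr
  nlinarith

end twist

/-- Minus the derivative of `sweep`. -/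
def sweepRate (r d β : ℝ) : ℝ :=
  2 / r * (twist r d 1 + cot β * sineIntegral (twistSlope r d) β)

theorem hasDerivAt_sweep {r d : ℝ} (hr : 0 < r) (hd : 0 < d) {β : ℝ} (hβ : β ∈ Ioo 0 π) :
    HasDerivAt (sweep r d) (-sweepRate r d β) β := by
  refine ((hasDerivAt_sineIntegral (fun w hw => hasDerivAt_twist hr hd hw)
    (continuousOn_twistSlope hr hd) hβ).const_mul (2 / r)).congr_deriv ?_
  rw [sweepRate]
  ring

/-- The expansion factor, in terms of the derivative of `sweep`. -/
def expansionFormula (r d β : ℝ) : ℝ :=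
  (d ^ r * cos β + r / twist r d 1) * sweepRate r d β - 1

theorem cot_nonneg_of_mem {β : ℝ} (hβ : β ∈ Ioo 0 (π / 2)) : 0 ≤ cot β := by
  rw [cot_eq_cos_div_sin]
  exact div_nonneg (cos_nonneg_of_mem_Icc ⟨by linarith [hβ.1, pi_pos], hβ.2.le⟩)
    (sin_nonneg_of_mem_Icc ⟨hβ.1.le, by linarith [hβ.2, pi_pos]⟩)

theorem sineIntegral_twistSlope_nonneg {r d : ℝ} (hr : 1 < r) (hd : 0 < d) {β : ℝ}
    (hβ : β ∈ Ioo 0 (π / 2)) : 0 ≤ sineIntegral (twistSlope r d) β := by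
  have := sineIntegral_mono continuousOn_const (continuousOn_twistSlope (zero_lt_one.trans hr) hd)
    (fun w hw => twistSlope_nonneg hr hd hw) hβ
  rwa [sineIntegral_const, mul_zero] at this

theorem le_sweepRate {r d : ℝ} (hr : 1 < r) (hd : 0 < d) {β : ℝ} (hβ : β ∈ Ioo 0 (π / 2)) :
    2 / r * twist r d 1 ≤ sweepRate r d β := by
  have h1 := mul_nonneg (cot_nonneg_of_mem hβ) (sineIntegral_twistSlope_nonneg hr hd hβ)
  have hr0 : 0 < r := by linarith
  unfold sweepRate
  gcongr
  linarith

/-- This absorbs the `-1` of `expansionFormula` and settles the sign of the covariant component in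
`expansionAt_eq`. -/
theorem two_le_mul_sweepRate {r d : ℝ} (hr : 1 < r) (hd : 0 < d) {β : ℝ}
    (hβ : β ∈ Ioo 0 (π / 2)) : 2 ≤ r / twist r d 1 * sweepRate r d β := by
  have hr0 : 0 < r := by linarith
  have ht := twist_pos hr0 hd one_pos
  calc 2 = r / twist r d 1 * (2 / r * twist r d 1) := by field_simp
    _ ≤ _ := by gcongr; exact le_sweepRate hr hd hβ

/-- Both branches of the return map, `β > 0` and `β < 0`, have this shape. -/
theorem hasFDerivAt_shear {f : ℝ → ℝ} {f' c : ℝ} {p : ℝ × ℝ} (hf : HasDerivAt f f' p.2) :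
    ∃ L : ℝ × ℝ →L[ℝ] ℝ × ℝ, HasFDerivAt (fun p : ℝ × ℝ => (p.1 + f p.2, c - p.2)) L p ∧
      L (0, 1) = (f', -1) := by
  have h2 : HasFDerivAt (fun p : ℝ × ℝ => p.2) (ContinuousLinearMap.snd ℝ ℝ ℝ) p := hasFDerivAt_snd
  exact ⟨_, (hasFDerivAt_fst.add (hf.comp_hasFDerivAt p h2)).prodMk
    (h2.const_sub c), by simp⟩

theorem exists_isFirstReturnAt {r d : ℝ} (hr : 1 < r) (hd : 0 < d) {p : ℝ × ℝ}
    (hp : p ∈ incoming) : ∃ q T, IsFirstReturnAt r d p T q := by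
  obtain ⟨h1, h2⟩ := abs_lt.1 hp.2
  rcases lt_or_gt_of_ne hp.1 with h | h
  · exact ⟨_, exists_isFirstReturnAt_of_neg hr hd h h1⟩
  · exact ⟨_, exists_isFirstReturnAt_of_pos hr hd h h2⟩

theorem exists_hasFDerivAt_firstReturn {r d : ℝ} (hr : 1 < r) (hd : 0 < d) {p : ℝ × ℝ}
    (hp : p ∈ incoming) : ∃ L : ℝ × ℝ →L[ℝ] ℝ × ℝ, HasFDerivAt (firstReturn r d) L p ∧
      L (0, 1) = (-sweepRate r d |p.2|, -1) ∧ cos (firstReturn r d p).2 = -cos p.2 := by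
  have hr0 : 0 < r := by linarith
  obtain ⟨h1, h2⟩ := abs_lt.1 hp.2
  rcases lt_or_gt_of_ne hp.1 with h | h
  · have heq : ∀ p : ℝ × ℝ, p.2 ∈ Ioo (-(π / 2)) 0 →
        firstReturn r d p = (p.1 + -sweep r d (-p.2), -π - p.2) := fun p hp => by
      obtain ⟨T, hT⟩ := exists_isFirstReturnAt_of_neg hr hd hp.2 hp.1
      rw [← sub_eq_add_neg]
      exact firstReturn_eq hd hT
    have hder : HasDerivAt (fun β => -sweep r d (-β)) (-sweepRate r d (-p.2)) p.2 := by
      have := ((hasDerivAt_sweep hr0 hd (β := -p.2) ⟨by linarith, by linarith [pi_pos]⟩).comp p.2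
        (hasDerivAt_neg p.2)).neg
      exact this.congr_deriv (by ring)
    obtain ⟨L, hL, hL1⟩ := hasFDerivAt_shear (c := -π) hder
    refine ⟨L, hL.congr_of_eventuallyEq ?_, by rw [hL1, abs_of_neg h], ?_⟩
    · filter_upwards [continuous_snd.continuousAt.preimage_mem_nhds
        (isOpen_Ioo.mem_nhds (show p.2 ∈ Ioo (-(π / 2)) 0 from ⟨h1, h⟩))] with q hq
      exact heq q hq
    · rw [heq p ⟨h1, h⟩, show -π - p.2 = -(p.2 + π) by ring, cos_neg, cos_add_pi]
  · have heq : ∀ p : ℝ × ℝ, p.2 ∈ Ioo 0 (π / 2) →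
        firstReturn r d p = (p.1 + sweep r d p.2, π - p.2) := fun p hp => by
      obtain ⟨T, hT⟩ := exists_isFirstReturnAt_of_pos hr hd hp.1 hp.2
      exact firstReturn_eq hd hT
    obtain ⟨L, hL, hL1⟩ := hasFDerivAt_shear (c := π)
      (hasDerivAt_sweep hr0 hd (β := p.2) ⟨h, by linarith⟩)
    refine ⟨L, hL.congr_of_eventuallyEq ?_, by rw [hL1, abs_of_pos h], ?_⟩
    · filter_upwards [continuous_snd.continuousAt.preimage_mem_nhds
        (isOpen_Ioo.mem_nhds (show p.2 ∈ Ioo 0 (π / 2) from ⟨h, h2⟩))] with q hq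
      exact heq q hq
    · rw [heq p ⟨h, h2⟩, cos_pi_sub]

/-- `twist_eq` at `s = S`, where the height is `d`. -/
theorem geodesic_curvature_eq {r d : ℝ} (hr : 0 < r) (hd : 0 < d) :
    r * d ^ (r - 1) / meridianSpeed r d = r / twist r d 1 := by
  have h := twist_eq hr hd one_pos one_pos
  rw [div_one, clairautHeight_self one_pos] at h
  have := meridianSpeed_pos r d
  rw [h, Real.rpow_sub_one hd.ne']
  have : 0 < d ^ r := by positivity
  field_simp

theorem abs_mem_Ioo_of_incoming {p : ℝ × ℝ} (hp : p ∈ incoming) : |p.2| ∈ Ioo 0 (π / 2) :=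
  ⟨abs_pos.2 hp.1, hp.2⟩

/-- The image vector is `(-R, -1)` at an angle of cosine `-cos β`: its components are `d ^ r * cos β
* R` and `κ * R - 1`, both nonnegative. -/
theorem expansionAt_eq {r d : ℝ} (hr : 1 < r) (hd : 0 < d) {p : ℝ × ℝ} (hp : p ∈ incoming) :
    expansionAt r d p = expansionFormula r d |p.2| := by
  have hr0 : 0 < r := by linarith
  have hβ := abs_mem_Ioo_of_incoming hp
  obtain ⟨L, hL, hL1, hcos⟩ := exists_hasFDerivAt_firstReturn hr hd hp
  have hc : 0 ≤ cos p.2 := by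
    rw [← cos_abs]
    exact cos_nonneg_of_mem_Icc ⟨by linarith [hβ.1, pi_pos], hβ.2.le⟩
  have h2 := two_le_mul_sweepRate hr hd hβ
  have ht := twist_pos hr0 hd one_pos
  have hR : 0 ≤ sweepRate r d |p.2| := le_trans (by positivity) (le_sweepRate hr hd hβ)
  have hD : 0 ≤ d ^ r := by positivity
  rw [expansionAt, hL.fderiv, hL1]
  simp only [jacobiNorm, hcos, geodesic_curvature_eq hr0 hd]
  have e1 : |d ^ r * -cos p.2 * -sweepRate r d (|p.2|)| = d ^ r * cos p.2 * sweepRate r d |p.2| := by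
    rw [mul_neg, mul_neg, neg_mul, neg_neg, abs_of_nonneg (by positivity)]
  have e2 : |(-1 : ℝ) - r / twist r d 1 * -sweepRate r d (|p.2|)|
      = r / twist r d 1 * sweepRate r d |p.2| - 1 := by
    rw [abs_of_nonneg (by linarith)]; ring
  rw [e1, e2, expansionFormula, cos_abs]
  simp only [mul_zero, abs_zero, sub_zero, abs_one, zero_add, div_one]
  ring

theorem expansion_eq {r d : ℝ} (hr : 1 < r) (hd : 0 < d) {β : ℝ} (h0 : β ≠ 0) (h1 : |β| < π / 2) :
    expansion r d β = expansionFormula r d |β| :=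
  expansionAt_eq (p := (0, β)) hr hd ⟨h0, h1⟩

theorem mul_sweepRate_le_expansionFormula {r d : ℝ} (hr : 1 < r) (hd : 0 < d) {β : ℝ}
    (hβ : β ∈ Ioo 0 (π / 2)) :
    r / twist r d 1 * sweepRate r d β / 2 ≤ expansionFormula r d β := by
  have h2 := two_le_mul_sweepRate hr hd hβ
  have hr0 : 0 < r := by linarith
  have ht := twist_pos hr0 hd one_pos
  have hR : 0 ≤ sweepRate r d β := le_trans (by positivity) (le_sweepRate hr hd hβ)
  have hc : 0 ≤ cos β := cos_nonneg_of_mem_Icc ⟨by linarith [hβ.1, pi_pos], hβ.2.le⟩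
  have : 0 ≤ d ^ r * cos β * sweepRate r d β := by positivity
  unfold expansionFormula
  linarith

theorem expansionFormula_pos {r d : ℝ} (hr : 1 < r) (hd : 0 < d) {β : ℝ}
    (hβ : β ∈ Ioo 0 (π / 2)) : 0 < expansionFormula r d β := by
  linarith [mul_sweepRate_le_expansionFormula hr hd hβ, two_le_mul_sweepRate hr hd hβ]

/-! ### Bounds for the expansion factor and its logarithmic derivative -/

theorem hasDerivAt_cot {β : ℝ} (h : sin β ≠ 0) : HasDerivAt cot (-(1 + cot β ^ 2)) β := by
  have hc : cot = fun x => cos x / sin x := funext cot_eq_cos_div_sin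
  rw [hc]
  refine ((hasDerivAt_cos β).div (hasDerivAt_sin β) h).congr_deriv ?_
  field_simp
  ring

theorem cot_le_inv {β : ℝ} (hβ : β ∈ Ioo 0 (π / 2)) : cot β ≤ β⁻¹ := by
  have hc := cos_pos_of_mem_Ioo ⟨by linarith [hβ.1, pi_pos], hβ.2⟩
  have hs := sin_pos_of_mem_Ioo ⟨hβ.1, by linarith [hβ.2, pi_pos]⟩
  have ht := lt_tan hβ.1 hβ.2
  rw [tan_eq_sin_div_cos, lt_div_iff₀ hc] at ht
  rw [cot_eq_cos_div_sin, div_le_iff₀ hs, inv_mul_eq_div, le_div_iff₀ hβ.1]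
  linarith

section

variable {r d : ℝ}

theorem sineIntegral_twistSlope_le (hr : 1 < r) (hd : 0 < d) {β : ℝ} (hβ : β ∈ Ioo 0 (π / 2)) :
    sineIntegral (twistSlope r d) β ≤ twist r d 1 * cot β := by
  have := sineIntegral_mono (continuousOn_twistSlope (zero_lt_one.trans hr) hd)
    (g := fun w => twist r d 1 * w) (by fun_prop) (fun w hw => twistSlope_le hr hd hw) hβ
  rwa [sineIntegral_const_mul, sineIntegral_id] at this

theorem le_sineIntegral_twistSlope (hr : 1 < r) (hd : 0 < d) {β : ℝ} (hβ : β ∈ Ioo 0 (π / 2)) :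
    (π / 2 - β) * twistSlope r d 1 ≤ sineIntegral (twistSlope r d) β := by
  have := sineIntegral_mono continuousOn_const (continuousOn_twistSlope (zero_lt_one.trans hr) hd)
    (fun w hw => twistSlope_one_le hr hd hw) hβ
  rwa [sineIntegral_const] at this

theorem sineIntegral_twistCurvature_nonneg (hr : 1 < r) (hd : 0 < d) {β : ℝ}
    (hβ : β ∈ Ioo 0 (π / 2)) : 0 ≤ sineIntegral (twistCurvature r d) β := by
  have := sineIntegral_mono continuousOn_const
    (continuousOn_twistCurvature (zero_lt_one.trans hr) hd)
    (fun w hw => twistCurvature_nonneg hr hd hw) hβ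
  rwa [sineIntegral_const, mul_zero] at this

theorem sineIntegral_twistCurvature_le (hr : 1 < r) (hd : 0 < d) {β : ℝ}
    (hβ : β ∈ Ioo 0 (π / 2)) :
    sineIntegral (twistCurvature r d) β ≤ 2 * sineIntegral (twistSlope r d) β := by
  have hr0 := zero_lt_one.trans hr
  have := sineIntegral_mono (g := fun w => 2 * twistSlope r d w) (continuousOn_twistCurvature hr0 hd)
    (continuousOn_const.mul (continuousOn_twistSlope hr0 hd))
    (fun w hw => twistCurvature_le hr hd hw) hβ
  rwa [sineIntegral_const_mul] at this

theorem sweepRate_pos (hr : 1 < r) (hd : 0 < d) {β : ℝ} (hβ : β ∈ Ioo 0 (π / 2)) :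
    0 < sweepRate r d β := by
  have hr0 := zero_lt_one.trans hr
  have := twist_pos hr0 hd one_pos
  exact lt_of_lt_of_le (by positivity) (le_sweepRate hr hd hβ)

theorem exists_hasDerivAt_sweepRate (hr : 1 < r) (hd : 0 < d) {β : ℝ} (hβ : β ∈ Ioo 0 (π / 2)) :
    ∃ R', HasDerivAt (sweepRate r d) R' β ∧ |R'| ≤ 3 * β⁻¹ * sweepRate r d β := by
  have hr0 := zero_lt_one.trans hr
  have hβ' : β ∈ Ioo 0 π := ⟨hβ.1, by linarith [hβ.2, pi_pos]⟩
  have h := (((hasDerivAt_cot (sin_pos_of_mem_Ioo hβ').ne').mul (hasDerivAt_sineIntegral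
    (fun w hw => hasDerivAt_twistSlope hr0 hd hw) (continuousOn_twistCurvature hr0 hd)
    hβ')).const_add (twist r d 1)).const_mul (2 / r)
  refine ⟨_, h, ?_⟩
  have hc := cot_nonneg_of_mem hβ
  have hK := sineIntegral_twistSlope_nonneg hr hd hβ
  have hK1 := sineIntegral_twistSlope_le hr hd hβ
  have hK2 := sineIntegral_twistCurvature_nonneg hr hd hβ
  have hK3 := sineIntegral_twistCurvature_le hr hd hβ
  have hS := twistSlope_one_pos hr hd
  have hS1 := twistSlope_le hr hd le_rfl
  rw [mul_one] at hS1
  have hR := (sweepRate_pos hr hd hβ).le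
  have hB := (twist_pos hr0 hd one_pos).le
  refine le_trans ?_ (mul_le_mul_of_nonneg_right
    (mul_le_mul_of_nonneg_left (cot_le_inv hβ) (by norm_num : (0 : ℝ) ≤ 3)) hR)
  unfold sweepRate
  generalize sineIntegral (twistSlope r d) β = K at *
  generalize sineIntegral (twistCurvature r d) β = K₂ at *
  generalize cot β = c at *
  generalize twistSlope r d 1 = S at *
  generalize twist r d 1 = B at *
  have e : 2 / r * (-(1 + c ^ 2) * K + c * -(S + c * K₂))
      = -(2 / r * (K + c ^ 2 * K + c * S + c ^ 2 * K₂)) := by ring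
  rw [e, abs_neg, abs_of_nonneg (by positivity)]
  have h1 : c * S ≤ c * B := by gcongr
  have h2 : c ^ 2 * K₂ ≤ c ^ 2 * (2 * K) := by gcongr
  have h3 : 0 ≤ c * B := by positivity
  -- Termwise: `K ≤ c * B`, `c * S ≤ c * B` and `c ^ 2 * K₂ ≤ 2 * c ^ 2 * K`; the total is at most
  -- `2 * c * B + 3 * c ^ 2 * K`, whence the 3.
  have h4 : 2 / r * (K + c ^ 2 * K + c * S + c ^ 2 * K₂) ≤ 2 / r * (3 * c * (B + c * K)) := by
    gcongr
    nlinarith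
  linarith

theorem exists_hasDerivAt_expansionFormula (hr : 1 < r) (hd : 0 < d) : ∃ C, 0 < C ∧
    ∀ β ∈ Ioo 0 (π / 2), ∃ L', HasDerivAt (expansionFormula r d) L' β ∧
      |L'| ≤ C * β⁻¹ * expansionFormula r d β := by
  have hr0 := zero_lt_one.trans hr
  have hB := twist_pos hr0 hd one_pos
  set κ := r / twist r d 1 with hκ
  have hκ0 : 0 < κ := by positivity
  have hD : 0 < d ^ r := by positivity
  refine ⟨(2 * d ^ r + 3 * (d ^ r + κ)) * (2 / κ), by positivity, fun β hβ => ?_⟩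
  obtain ⟨R', hR', hb⟩ := exists_hasDerivAt_sweepRate hr hd hβ
  have hR := sweepRate_pos hr hd hβ
  refine ⟨_, ((((hasDerivAt_cos β).const_mul (d ^ r)).add_const κ).mul hR').sub_const 1, ?_⟩
  have hΛ := mul_sweepRate_le_expansionFormula hr hd hβ
  rw [← hκ] at hΛ
  have hi : 0 < β⁻¹ := inv_pos.2 hβ.1
  -- As `β < 2`, the bounded term from differentiating `cos β` can be charged to `β⁻¹`.
  have h1 : (1 : ℝ) ≤ 2 * β⁻¹ := by
    rw [← div_eq_mul_inv, one_le_div hβ.1]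
    linarith [hβ.2, pi_le_four]
  have hR2 : sweepRate r d β ≤ 2 / κ * expansionFormula r d β := by
    rw [div_mul_eq_mul_div, le_div_iff₀ hκ0]; linarith
  have a1 : |d ^ r * -sin β * sweepRate r d β| ≤ d ^ r * (2 * β⁻¹) * sweepRate r d β := by
    rw [abs_mul, abs_mul, abs_neg, abs_of_pos hD, abs_of_pos hR]
    gcongr
    exact (abs_sin_le_one β).trans h1
  have a2 : |(d ^ r * cos β + κ) * R'| ≤ (d ^ r + κ) * (3 * β⁻¹ * sweepRate r d β) := by
    rw [abs_mul]
    gcongr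
    refine (abs_add_le _ _).trans ?_
    rw [abs_mul, abs_of_pos hD, abs_of_pos hκ0]
    nlinarith [abs_cos_le_one β]
  calc _ ≤ d ^ r * (2 * β⁻¹) * sweepRate r d β + (d ^ r + κ) * (3 * β⁻¹ * sweepRate r d β) :=
        (abs_add_le _ _).trans (add_le_add a1 a2)
    _ = (2 * d ^ r + 3 * (d ^ r + κ)) * β⁻¹ * sweepRate r d β := by ring
    _ ≤ (2 * d ^ r + 3 * (d ^ r + κ)) * β⁻¹ * (2 / κ * expansionFormula r d β) := by gcongr
    _ = _ := by ring

theorem exists_hasDerivAt_expansion (hr : 1 < r) (hd : 0 < d) : ∃ C, 0 < C ∧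
    ∀ β : ℝ, β ≠ 0 → |β| < π / 2 → ∃ L', HasDerivAt (expansion r d) L' β ∧
      |L'| ≤ C * |β|⁻¹ * expansion r d β := by
  obtain ⟨C, hC, h⟩ := exists_hasDerivAt_expansionFormula hr hd
  refine ⟨C, hC, fun β h0 h1 => ?_⟩
  obtain ⟨L', hL', hb⟩ := h |β| ⟨abs_pos.2 h0, h1⟩
  refine ⟨_, (hL'.comp β (hasDerivAt_abs h0)).congr_of_eventuallyEq ?_, ?_⟩
  · have ho : IsOpen {β : ℝ | β ≠ 0 ∧ |β| < π / 2} :=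
      isOpen_ne.inter (isOpen_lt continuous_abs continuous_const)
    filter_upwards [ho.mem_nhds ⟨h0, h1⟩] with x hx
    exact expansion_eq hr hd hx.1 hx.2
  · rw [expansion_eq hr hd h0 h1, abs_mul]
    have : |((SignType.sign β : SignType) : ℝ)| = 1 := by
      rcases lt_or_gt_of_ne h0 with h | h
      · simp [sign_neg h]
      · simp [sign_pos h]
    rw [this, mul_one]
    exact hb

theorem expansion_pos (hr : 1 < r) (hd : 0 < d) {β : ℝ} (h0 : β ≠ 0) (h1 : |β| < π / 2) :
    0 < expansion r d β := by
  rw [expansion_eq hr hd h0 h1]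
  exact expansionFormula_pos hr hd ⟨abs_pos.2 h0, h1⟩

/-! ### Growth of the expansion factor and the final estimates -/

theorem exists_le_expansion (hr : 1 < r) (hd : 0 < d) : ∃ c, 0 < c ∧
    ∀ β : ℝ, β ≠ 0 → |β| ≤ 1 → c * |β|⁻¹ ≤ expansion r d β := by
  have hr0 := zero_lt_one.trans hr
  have hB := twist_pos hr0 hd one_pos
  have hS := twistSlope_one_pos hr hd
  -- One factor `1 / 2` is the bound for `cos` on `[0, 1]`, one bounds the length `π / 2 - 1` of the
  -- integration interval, and the last halving comes from `Λ ≥ κ * R / 2`.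
  refine ⟨r / twist r d 1 * (2 / r * (1 / 2 * (1 / 2 * twistSlope r d 1))) / 2, by positivity,
    fun β h0 h1 => ?_⟩
  have hpi : (3 : ℝ) < π := pi_gt_three
  have hβ : |β| ∈ Ioo 0 (π / 2) := ⟨abs_pos.2 h0, by linarith⟩
  rw [expansion_eq hr hd h0 hβ.2]
  generalize |β| = b at *
  refine le_trans ?_ (mul_sweepRate_le_expansionFormula hr hd hβ)
  have hs : 0 < sin b := sin_pos_of_mem_Ioo ⟨hβ.1, by linarith [hβ.2]⟩
  have hcot : 1 / 2 * b⁻¹ ≤ cot b := by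
    rw [cot_eq_cos_div_sin, ← div_eq_mul_inv]
    have hc : 1 / 2 ≤ cos b := by
      linarith [one_sub_sq_div_two_le_cos (x := b), pow_le_one₀ (n := 2) hβ.1.le h1]
    exact div_le_div₀ (by linarith) hc hs (sin_le hβ.1.le)
  have hK : 1 / 2 * twistSlope r d 1 ≤ sineIntegral (twistSlope r d) b := by
    refine le_trans ?_ (le_sineIntegral_twistSlope hr hd hβ)
    gcongr
    linarith
  have hi : 0 < b⁻¹ := inv_pos.2 hβ.1
  have hprod : 1 / 2 * b⁻¹ * (1 / 2 * twistSlope r d 1) ≤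
      twist r d 1 + cot b * sineIntegral (twistSlope r d) b := by
    have := mul_le_mul hcot hK (by positivity) (cot_nonneg_of_mem hβ)
    linarith
  calc _ = r / twist r d 1 * (2 / r * (1 / 2 * b⁻¹ * (1 / 2 * twistSlope r d 1))) / 2 := by ring
    _ ≤ _ := by unfold sweepRate; gcongr

/-- For `k ≥ 1` the strip is nonempty, compact and inside `0 < |β| ≤ 1`, where `Λ` is continuous. -/
theorem isLeast_stripMin (hr : 1 < r) (hd : 0 < d) {ν : ℝ} (hν : 0 < ν) {k : ℕ} (hk : 1 ≤ k) :
    IsLeast (expansion r d '' strip ν k) (stripMin r d ν k) ∧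
      ∃ β ∈ strip ν k, β ≠ 0 ∧ |β| ≤ 1 ∧ stripMin r d ν k = expansion r d β := by
  have hk0 : (1 : ℝ) ≤ k := by exact_mod_cast hk
  have hmem : ∀ β ∈ strip ν k, β ≠ 0 ∧ |β| ≤ 1 := fun β hβ => by
    refine ⟨abs_pos.1 (lt_of_lt_of_le (by positivity) hβ.1), hβ.2.trans ?_⟩
    exact div_le_one_of_le₀ (Real.one_le_rpow hk0 hν.le) (by positivity)
  have hcomp : IsCompact (strip ν k) := by
    refine IsCompact.of_isClosed_subset (isCompact_Icc (a := (-1 : ℝ)) (b := 1)) ?_ fun β hβ =>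
      abs_le.1 (hmem β hβ).2
    exact (isClosed_le continuous_const continuous_abs).inter
      (isClosed_le continuous_abs continuous_const)
  have hne : (strip ν k).Nonempty := by
    refine ⟨1 / (k : ℝ) ^ ν, ?_, ?_⟩
    · rw [abs_of_pos (by positivity)]
      gcongr
      linarith
    · rw [abs_of_pos (by positivity)]
  obtain ⟨C, -, hder⟩ := exists_hasDerivAt_expansion hr hd
  have hcont : ContinuousOn (expansion r d) (strip ν k) := fun β hβ => by
    obtain ⟨h0, h1⟩ := hmem β hβ
    obtain ⟨L', hL', -⟩ := hder β h0 (by linarith [pi_gt_three])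
    exact hL'.continuousAt.continuousWithinAt
  have hleast : IsLeast (expansion r d '' strip ν k) (stripMin r d ν k) :=
    (hcomp.image_of_continuousOn hcont).isLeast_sInf (hne.image _)
  obtain ⟨β, hβ, hβe⟩ := hleast.1
  exact ⟨hleast, β, hβ, (hmem β hβ).1, (hmem β hβ).2, hβe.symm⟩

theorem exists_le_stripMin (hr : 1 < r) (hd : 0 < d) {ν : ℝ} (hν : 0 < ν) : ∃ c, 0 < c ∧
    ∀ k : ℕ, 1 ≤ k → c * (k : ℝ) ^ ν ≤ stripMin r d ν k := by
  obtain ⟨c, hc, h⟩ := exists_le_expansion hr hd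
  refine ⟨c, hc, fun k hk => ?_⟩
  obtain ⟨-, β, hβ, h0, h1, he⟩ := isLeast_stripMin hr hd hν hk
  have hk0 : (0 : ℝ) < k := by exact_mod_cast hk
  rw [he]
  refine le_trans ?_ (h β h0 h1)
  gcongr
  rw [le_inv_comm₀ (by positivity) (abs_pos.2 h0), ← one_div]
  exact hβ.2

theorem exists_tsum_inv_stripMin_lt_one (hr : 1 < r) (hd : 0 < d) {ν : ℝ} (hν : 1 < ν) :
    ∃ k₀ : ℕ, 1 ≤ k₀ ∧ Summable (fun i : ℕ => (stripMin r d ν (k₀ + i))⁻¹) ∧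
      ∑' i : ℕ, (stripMin r d ν (k₀ + i))⁻¹ < 1 := by
  obtain ⟨c, hc, h⟩ := exists_le_stripMin hr hd (zero_lt_one.trans hν)
  set f : ℕ → ℝ := fun k => c⁻¹ * (1 / (k : ℝ) ^ ν) with hf
  have hfs : Summable f := (Real.summable_one_div_nat_rpow.2 hν).mul_left _
  -- Tails of the convergent series `∑ c⁻¹ * k ^ (-ν)` tend to 0; `k₀` may depend on `d` through
  -- `c`.
  obtain ⟨k₀, hlt, hk₀⟩ := (((tendsto_sum_nat_add f).eventually (gt_mem_nhds one_pos)).and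
    (eventually_ge_atTop 1)).exists
  have hpos : ∀ i : ℕ, (0 : ℝ) < ((k₀ + i : ℕ) : ℝ) := fun i => by
    have : 0 < k₀ + i := by omega
    exact_mod_cast this
  have hbound : ∀ i, (stripMin r d ν (k₀ + i))⁻¹ ≤ f (i + k₀) := fun i => by
    have hp := hpos i
    have hp' : 0 < c * ((k₀ + i : ℕ) : ℝ) ^ ν := by positivity
    rw [hf, add_comm i]
    simp only
    rw [one_div, ← mul_inv]
    exact inv_anti₀ hp' (h _ (by omega))
  have hnonneg : ∀ i, 0 ≤ (stripMin r d ν (k₀ + i))⁻¹ := fun i => by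
    have hp := hpos i
    exact inv_nonneg.2 (le_trans (by positivity) (h (k₀ + i) (by omega)))
  have hfs' : Summable fun i => f (i + k₀) := (summable_nat_add_iff k₀).2 hfs
  have hsum := Summable.of_nonneg_of_le hnonneg hbound hfs'
  exact ⟨k₀, hk₀, hsum, (hsum.tsum_le_tsum hbound hfs').trans_lt hlt⟩

/-- The exponent 1 already suffices; since `|β| < 2` and `0 ≤ θ - 1 ≤ 1`, passing to `θ` costs a
factor 2. -/
theorem abs_deriv_expansion_div_le (hr : 1 < r) (hd : 0 < d) {θ : ℝ} (h1 : 1 ≤ θ) (h2 : θ ≤ 2) :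
    ∃ C, 0 < C ∧ ∀ β : ℝ, β ≠ 0 → |β| < π / 2 → DifferentiableAt ℝ (expansion r d) β ∧
      |deriv (expansion r d) β / expansion r d β| ≤ C * (1 / |β| ^ θ) := by
  obtain ⟨C, hC, h⟩ := exists_hasDerivAt_expansion hr hd
  refine ⟨C * 2, by positivity, fun β h0 hβ => ?_⟩
  obtain ⟨L', hL', hb⟩ := h β h0 hβ
  have hΛ := expansion_pos hr hd h0 hβ
  refine ⟨hL'.differentiableAt, ?_⟩
  rw [hL'.deriv, abs_div, abs_of_pos hΛ, div_le_iff₀ hΛ]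
  refine hb.trans ?_
  have hb0 := abs_pos.2 h0
  have hpow : |β| ^ (θ - 1) ≤ 2 := by
    calc |β| ^ (θ - 1) ≤ 2 ^ (θ - 1) :=
          Real.rpow_le_rpow hb0.le (by linarith [pi_le_four]) (by linarith)
      _ ≤ 2 ^ (1 : ℝ) := Real.rpow_le_rpow_of_exponent_le (by norm_num) (by linarith)
      _ = 2 := Real.rpow_one 2
  have hinv : |β|⁻¹ ≤ 2 * (1 / |β| ^ θ) := by
    rw [Real.rpow_sub_one hb0.ne', div_le_iff₀ hb0] at hpow
    have : 0 < |β| ^ θ := by positivity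
    rw [mul_one_div, le_div_iff₀ this, inv_mul_le_iff₀ hb0]
    linarith
  rw [mul_assoc C 2]
  gcongr

end

end ToyCusp

end

theorem propositionp (r : ℝ) (hr : 3 < r) :
    -- the first-return map and the expansion factor are well defined
    (∀ d : ℝ, 0 < d → ∀ p ∈ ToyCusp.incoming,
      (∃! q : ℝ × ℝ, ∃ T : ℝ, ToyCusp.IsFirstReturnAt r d p T q) ∧
      DifferentiableAt ℝ (ToyCusp.firstReturn r d) p ∧
      0 < ToyCusp.expansionAt r d p ∧
      ToyCusp.expansionAt r d p = ToyCusp.expansion r d p.2) ∧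
    -- one-step growth condition
    (∀ ν : ℝ, r / (r - 1) < ν → ∃ δ : ℝ, 0 < δ ∧ ∀ d : ℝ, 0 < d → d < δ →
      ∃ k₀ : ℕ, 1 ≤ k₀ ∧
        (∀ k : ℕ, k₀ ≤ k → 0 < ToyCusp.stripMin r d ν k ∧
          IsLeast (ToyCusp.expansion r d '' ToyCusp.strip ν k) (ToyCusp.stripMin r d ν k)) ∧
        Summable (fun i : ℕ => (ToyCusp.stripMin r d ν (k₀ + i))⁻¹) ∧
        ∑' i : ℕ, (ToyCusp.stripMin r d ν (k₀ + i))⁻¹ < 1) ∧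
    -- distortion bound
    (∃ ν θ : ℝ, r / (r - 1) < ν ∧ 1 + 2 / r < θ ∧ ν * θ < ν + 1 ∧
      ∃ δ : ℝ, 0 < δ ∧ ∀ d : ℝ, 0 < d → d < δ →
        ∃ C : ℝ, 0 < C ∧ ∀ β : ℝ, β ≠ 0 → |β| < Real.pi / 2 →
          DifferentiableAt ℝ (ToyCusp.expansion r d) β ∧
          |deriv (ToyCusp.expansion r d) β / ToyCusp.expansion r d β| ≤ C * (1 / |β| ^ θ)) := by
  have hr1 : 1 < r := by linarith
  refine ⟨fun d hd p hp => ⟨?_, ?_, ?_, ?_⟩, fun ν hν => ?_, ?_⟩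
  · obtain ⟨q, T, h⟩ := ToyCusp.exists_isFirstReturnAt hr1 hd hp
    exact ⟨q, ⟨T, h⟩, fun q' ⟨T', h'⟩ => ToyCusp.IsFirstReturnAt.unique hd h' h⟩
  · obtain ⟨L, hL, -⟩ := ToyCusp.exists_hasFDerivAt_firstReturn hr1 hd hp
    exact hL.differentiableAt
  · rw [ToyCusp.expansionAt_eq hr1 hd hp]
    exact ToyCusp.expansionFormula_pos hr1 hd (ToyCusp.abs_mem_Ioo_of_incoming hp)
  · rw [ToyCusp.expansionAt_eq hr1 hd hp, ToyCusp.expansion_eq hr1 hd hp.1 hp.2]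
  · have hν1 : 1 < ν := by
      refine lt_trans ?_ hν
      rw [one_lt_div (by linarith)]
      linarith
    -- Any `δ` would do: the estimates hold for every `d > 0`.
    refine ⟨1, one_pos, fun d hd _ => ?_⟩
    obtain ⟨k₀, hk₀, hsum, hlt⟩ := ToyCusp.exists_tsum_inv_stripMin_lt_one hr1 hd hν1
    refine ⟨k₀, hk₀, fun k hk => ?_, hsum, hlt⟩
    obtain ⟨hleast, β, -, h0, h1, he⟩ :=
      ToyCusp.isLeast_stripMin hr1 hd (zero_lt_one.trans hν1) (hk₀.trans hk)
    refine ⟨?_, hleast⟩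
    rw [he]
    exact ToyCusp.expansion_pos hr1 hd h0 (by linarith [pi_gt_three])
  · have hr0 : 0 < r := by linarith
    -- The interval is nonempty exactly because `r > 3`.
    obtain ⟨ν, hν, hν'⟩ : ∃ ν, r / (r - 1) < ν ∧ ν < r / 2 := by
      refine exists_between ?_
      rw [div_lt_div_iff₀ (by linarith) two_pos]
      nlinarith
    have hν1 : 1 < ν := by
      refine lt_trans ?_ hν
      rw [one_lt_div (by linarith)]
      linarith
    have hν0 : 0 < ν := by linarith
    -- `ν < r / 2` means `2 / r < 1 / ν`, which makes room for `θ`; the upper bound gives `ν * θ < ν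
    -- + 1`, and `θ < 2` as `ν > 1`.
    obtain ⟨θ, hθ, hθ'⟩ : ∃ θ, 1 + 2 / r < θ ∧ θ < 1 + 1 / ν := by
      refine exists_between ?_
      have : 2 / r < 1 / ν := by
        rw [div_lt_div_iff₀ hr0 hν0]
        linarith
      linarith
    have h2r : 0 < 2 / r := by positivity
    have hνi : 1 / ν < 1 := by
      rw [div_lt_one hν0]
      exact hν1
    refine ⟨ν, θ, hν, hθ, ?_, 1, one_pos, fun d hd _ => ?_⟩
    · calc ν * θ < ν * (1 + 1 / ν) := by gcongr
        _ = ν + 1 := by field_simp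
    · exact ToyCusp.abs_deriv_expansion_div_le hr1 hd (by linarith) (by linarith)
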